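/- Let $G=\mathrm{Heis}(3;\mathbb R)\times\mathbb R$, with elements $(x,y,t,u)=\left(\begin{pmatrix}1&x&t\\0&1&y\\0&0&1\end{pmatrix},u\right)$, be identified with $\mathbb C^2$ through the coordinates $$z=\tfrac1{\sqrt2}(x+iy),\qquad w=t-\tfrac12xy-\tfrac i4(x^2+y^2)+iu ,$$ in which left translations are holomorphic. Let $\Gamma\subset G$ be a discrete subgroup such that the quotient $M=\Gamma\backslash G$ by left translations is compact (a primary Kodaira surface), with covering map $\pi\colon\mathbb C^2\to M$. Let $$\tilde\omega=\tfrac i2\partial\bar\partial\Phi,\qquad \Phi(z,w)=\exp\left(\tfrac14|z|^2-\tfrac i4(w-\bar w)\right)=e^{u/2},$$ be the Kähler form on the covering $\mathbb C^2$, and let $\omega$ be the locally conformally Kähler (lcK) form on $M$ with $\pi^*\omega=e^{-u/2}\tilde\omega$ (both are normalised only up to positive constant factors). Let $\omega_0=\frac i2\sum_j dz_j\wedge d\bar z_j$ be the flat Kähler form on $l^2(\mathbb C)$. For $\lambda\in\mathbb C\setminus\{0\}$ with $|\lambda|\ne1$ let $H^\infty_\lambda=(l^2(\mathbb C)\setminus\{0\})/\langle\lambda\cdot\mathrm{id}\rangle$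 be the classical Hopf manifold, with covering map $\pi_\lambda$ and lcK form $\omega_H$ given by $\pi_\lambda^*\omega_H=\|v\|^{-2}\omega_0$. An lcK map $f\colon (M,\omega)\to H^\infty_\lambda$ is a holomorphic map with $f^*\omega_H=\omega$. A map $F\colon\mathbb C^2\to l^2(\mathbb C)$ is said to induce $f\colon M\to H^\infty_\lambda$ if $F$ has no zeros and $f\circ\pi=\pi_\lambda\circ F$. Let $a>0$ and let $F\colon\mathbb C^2\to l^2(\mathbb C)$ be a Kähler map, that is, a holomorphic map with $F^*\omega_0=a\,\tilde\omega$. Then: 1. for every $\lambda\in\mathbb C\setminus\{0\}$ with $|\lambda|\neq1$ and every $b>0$, $F$ does not induce any lcK map from $(M,b\,\omega)$ to $H^\infty_\lambda$; 2. no unitary transformation or translation makes $F$ descend to the quotient: for every unitary transformation $U$ of $l^2(\mathbb C)$ and every $c\in l^2(\mathbb C)$, the map $U\circ F+c$ does not induce any map of sets $M\to H^\infty_\lambda$, for any $\lambda\in\mathbb C\setminus\{0\}$ with $|\lambda|\ne1$, and there is no map of sets $f\colon M\to l^2(\mathbb C)$ with $f\circ\pi=U\circ F+c$. -/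

import Mathlib

open Complex
open scoped InnerProductSpace

noncomputable section

namespace Kodaira

/-- The group `Heis(3; ℝ) × ℝ`; the element `⟨x, y, t, u⟩` is the pair consisting of the matrix
`!![1, x, t; 0, 1, y; 0, 0, 1]` and the real number `u`. -/
@[ext] structure HeisR where
  x : ℝ
  y : ℝ
  t : ℝ
  u : ℝ

namespace HeisR

instance : Mul HeisR := ⟨fun g h => ⟨g.x + h.x, g.y + h.y, g.t + h.t + g.x * h.y, g.u + h.u⟩⟩
instance : One HeisR := ⟨⟨0, 0, 0, 0⟩⟩
instance : Inv HeisR := ⟨fun g => ⟨-g.x, -g.y, -g.t + g.x * g.y, -g.u⟩⟩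

theorem mul_def (g h : HeisR) :
    g * h = ⟨g.x + h.x, g.y + h.y, g.t + h.t + g.x * h.y, g.u + h.u⟩ := rfl
theorem one_def : (1 : HeisR) = ⟨0, 0, 0, 0⟩ := rfl
theorem inv_def (g : HeisR) : g⁻¹ = ⟨-g.x, -g.y, -g.t + g.x * g.y, -g.u⟩ := rfl

instance : Group HeisR :=
  Group.ofLeftAxioms
    (fun a b c => by ext <;> simp only [mul_def] <;> ring)
    (fun a => by ext <;> simp [mul_def, one_def])
    (fun a => by ext <;> simp [mul_def, one_def, inv_def])

/-- The topology of `ℝ⁴`. -/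
instance : TopologicalSpace HeisR :=
  TopologicalSpace.induced (fun g => (g.x, g.y, g.t, g.u)) inferInstance

/-- The Heisenberg component as a matrix. -/
def toMatrix (g : HeisR) : Matrix (Fin 3) (Fin 3) ℝ := !![1, g.x, g.t; 0, 1, g.y; 0, 0, 1]

theorem toMatrix_mul (g h : HeisR) : (g * h).toMatrix = g.toMatrix * h.toMatrix := by
  ext i j
  fin_cases i <;> fin_cases j <;>
    simp [toMatrix, mul_def, Matrix.mul_apply, Fin.sum_univ_three] <;> ring

end HeisR

/-- The real coordinate `u` in terms of the holomorphic coordinates `(z, w)`. -/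
def uCoord (p : ℂ × ℂ) : ℝ := normSq p.1 / 2 + p.2.im

/-- The holomorphic coordinates `(z, w)` that identify `Heis(3; ℝ) × ℝ` with `ℂ²`:
`z = (x + i y) / √2` and `w = t - x y / 2 - (i / 4) (x² + y²) + i u`. -/
def coords : HeisR ≃ ℂ × ℂ where
  toFun g := (((g.x : ℂ) + I * g.y) / (Real.sqrt 2 : ℝ),
    (g.t : ℂ) - (g.x : ℂ) * g.y / 2 - I / 4 * ((g.x : ℂ) ^ 2 + (g.y : ℂ) ^ 2) + I * g.u)
  invFun p := ⟨Real.sqrt 2 * p.1.re, Real.sqrt 2 * p.1.im, p.2.re + p.1.re * p.1.im, uCoord p⟩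
  left_inv g := by
    have h2 : Real.sqrt 2 ^ 2 = 2 := Real.sq_sqrt (by norm_num)
    have h0 : Real.sqrt 2 ≠ 0 := by positivity
    ext
    · simp [div_ofReal_re]; field_simp
    · simp [div_ofReal_im]; field_simp
    · simp [div_ofReal_re, div_ofReal_im, pow_two]; field_simp; rw [h2]; ring
    · simp [uCoord, normSq_apply, pow_two]
      field_simp; ring
  right_inv p := by
    have h2 : Real.sqrt 2 ^ 2 = 2 := Real.sq_sqrt (by norm_num)
    have h0 : Real.sqrt 2 ≠ 0 := by positivity
    apply Prod.ext
    · apply Complex.ext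
      · simp [div_ofReal_re]
      · simp [div_ofReal_im]
    · apply Complex.ext
      · simp [pow_two]; linear_combination (-(p.1.re * p.1.im) / 2) * h2
      · simp [uCoord, normSq_apply, pow_two]
        linear_combination (-(p.1.re * p.1.re + p.1.im * p.1.im) / 4) * h2

/-- The compact complex surface `Γ \ (Heis(3; ℝ) × ℝ)`: orbits of left translations by `Γ`. -/
abbrev Surface (Γ : Subgroup HeisR) : Type := MulAction.orbitRel.Quotient Γ HeisR

/-- The universal covering map `ℂ² → Γ \ (Heis(3; ℝ) × ℝ)`. -/
def cover (Γ : Subgroup HeisR) (p : ℂ × ℂ) : Surface Γ :=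
  Quotient.mk (MulAction.orbitRel Γ HeisR) (coords.symm p)

/-- The real `(1,1)`-form `(i/2) ∂∂̄φ = (1/4) dd^c φ` on `ℂ²`, evaluated at the point `p` on the
tangent vectors `ξ`, `η`. Here `d^c φ = - dφ ∘ J`, so that
`dd^c φ (ξ, η) = D²φ (η, J ξ) - D²φ (ξ, J η)`. -/
def potentialForm (φ : ℂ × ℂ → ℝ) (p ξ η : ℂ × ℂ) : ℝ :=
  (1 / 4) * (fderiv ℝ (fderiv ℝ φ) p η (I • ξ) - fderiv ℝ (fderiv ℝ φ) p ξ (I • η))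

/-- The potential `Φ(z, w) = exp (|z|² / 4 - (i/4) (w - w̄)) = exp (u / 2)`. -/
def potential (p : ℂ × ℂ) : ℝ := Real.exp (uCoord p / 2)

/-- The Kähler form `(i/2) ∂∂̄Φ` on the universal covering `ℂ²`. -/
def kahlerForm (p ξ η : ℂ × ℂ) : ℝ := potentialForm potential p ξ η

/-- The lift to `ℂ²` of the locally conformally Kähler form of the surface. -/
def lckForm (p ξ η : ℂ × ℂ) : ℝ := Real.exp (-(uCoord p / 2)) * kahlerForm p ξ η

/-- The Hilbert space `l²(ℂ)`. -/
abbrev EllTwo : Type := lp (fun _ : ℕ => ℂ) 2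

/-- The flat Kähler form `(i/2) ∑ⱼ dzⱼ ∧ dz̄ⱼ` of `l²(ℂ)` on tangent vectors (the inner product is
conjugate linear in its first argument). -/
def flatForm (v w : EllTwo) : ℝ := (⟪v, w⟫_ℂ).im

/-- The pull-back of the flat Kähler form along a map `F` at the point `p`. -/
def pullback (F : ℂ × ℂ → EllTwo) (p ξ η : ℂ × ℂ) : ℝ :=
  flatForm (fderiv ℂ F p ξ) (fderiv ℂ F p η)

/-- `F` is a Kähler map from `ℂ²`, with the Kähler form `a • kahlerForm`, to `l²(ℂ)`. -/
def IsKahlerMap (a : ℝ) (F : ℂ × ℂ → EllTwo) : Prop :=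
  Differentiable ℂ F ∧ ∀ p ξ η, pullback F p ξ η = a * kahlerForm p ξ η

/-- Two nonzero vectors are equivalent if one is the other times an integer power of `lam`. -/
def hopfSetoid (lam : ℂˣ) : Setoid {v : EllTwo // v ≠ 0} :=
  (MulAction.orbitRel (Subgroup.zpowers lam) EllTwo).comap (↑)

/-- The classical Hopf manifold `(l²(ℂ) \ {0}) / ⟨lam • id⟩`. -/
def Hopf (lam : ℂˣ) : Type := Quotient (hopfSetoid lam)

/-- The covering map `l²(ℂ) \ {0} → (l²(ℂ) \ {0}) / ⟨lam • id⟩`. -/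
def hopfCover (lam : ℂˣ) (v : EllTwo) (hv : v ≠ 0) : Hopf lam :=
  Quotient.mk (hopfSetoid lam) ⟨v, hv⟩

/-- `f` is an lcK map from the surface, with the form whose lift is `b • lckForm`, to the Hopf
manifold with the form whose lift is `‖v‖⁻² • flatForm`: near every point `f` lifts to a
holomorphic map `G` on the covering spaces, and `f` pulls the second form back to the first. -/
def IsLcKMap {Γ : Subgroup HeisR} {lam : ℂˣ} (b : ℝ) (f : Surface Γ → Hopf lam) : Prop :=
  ∀ p : ℂ × ℂ, ∃ V : Set (ℂ × ℂ), IsOpen V ∧ p ∈ V ∧ ∃ G : ℂ × ℂ → EllTwo,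
    DifferentiableOn ℂ G V ∧ ∀ q ∈ V,
      (∃ hq : G q ≠ 0, f (cover Γ q) = hopfCover lam (G q) hq) ∧
      ∀ ξ η, (‖G q‖ ^ 2)⁻¹ * pullback G q ξ η = b * lckForm q ξ η

/-- `F : ℂ² → l²(ℂ)` takes values in `l²(ℂ) \ {0}` and induces `f` on the quotients. -/
def InducesToHopf {Γ : Subgroup HeisR} {lam : ℂˣ} (F : ℂ × ℂ → EllTwo)
    (f : Surface Γ → Hopf lam) : Prop :=
  ∀ p, ∃ hp : F p ≠ 0, f (cover Γ p) = hopfCover lam (F p) hp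

end Kodaira

end

/-!
The Kähler condition in the vertical direction reads `‖∂F/∂w‖² = (a / 16) e^{u / 2}`, and
`e^{u / 2} = |e^{-i w / 4}|² e^{|z|² / 4}`. Along an entire curve `w = φ z`, the vectors
`e^{i w / 4} ∂F/∂w` therefore depend holomorphically on `z` and have squared norm
`(a / 16) e^{|z|² / 4}`. By polarization their inner products are `(a / 16) e^{z z̄' / 4}`, as for
the coherent states of Fock space, so that no two of them with different `z` are parallel.

If `F` descends, every `γ ∈ Γ` satisfies `F (γ p) = μ(p) F p` with `μ(p)` in a countable set. On a
vertical line, Baire's theorem and the identity theorem make `μ` constant. Left translations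
preserve `∂/∂w`, so `∂F/∂w` is parallel at `γ p` and `p`, which forces `γ` to have coordinate
`z = 0`, that is, to be central. But a subgroup of the centre is not cocompact.
-/

namespace Kodaira

open Filter Metric Set
open scoped Topology ComplexConjugate

section HolomorphicMaps

variable {X E : Type*} [NormedAddCommGroup X] [NormedSpace ℂ X]
  [NormedAddCommGroup E] [NormedSpace ℂ E]

theorem norm_sub_sub_fderiv_le_of_mapsTo_ball {f : X → E} {c x : X} {R M : ℝ}
    (hf : DifferentiableOn ℂ f (ball c R)) (hM : MapsTo f (ball c R) (closedBall (f c) M))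
    (hx : x ∈ ball c R) : ‖f x - f c - fderiv ℂ f c (x - c)‖ ≤ 2 * M * (‖x - c‖ / R) ^ 2 := by
  have hR : 0 < R := nonempty_ball.1 ⟨x, hx⟩
  have hc : DifferentiableAt ℂ f c := hf.differentiableAt (ball_mem_nhds c hR)
  have hfderiv : ‖fderiv ℂ f c‖ ≤ M / R := norm_fderiv_le_div_of_mapsTo_ball hf hM hR
  have hmaps : MapsTo (fun y => f y - fderiv ℂ f c (y - c)) (ball c R)
      (closedBall (f c - fderiv ℂ f c (c - c)) (2 * M)) := by
    intro y hy
    have hlin : ‖fderiv ℂ f c (y - c)‖ ≤ M :=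
      ((fderiv ℂ f c).le_of_opNorm_le_of_le hfderiv (mem_ball_iff_norm.1 hy).le).trans_eq
        (div_mul_cancel₀ M hR.ne')
    rw [sub_self, map_zero, sub_zero, mem_closedBall_iff_norm, sub_right_comm]
    linarith [norm_sub_le (f y - f c) (fderiv ℂ f c (y - c)), mem_closedBall_iff_norm.1 (hM hy)]
  have hlittle := hc.hasFDerivAt.isLittleO
  have := dist_le_mul_div_pow_of_mapsTo_ball_of_isLittleO (n := 1) (by fun_prop) hmaps
    (by simpa [sub_right_comm] using hlittle.norm_right) hx
  simpa [dist_eq_norm, sub_right_comm] using this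

theorem tendstoLocallyUniformly_lineDiffQuot {f : X → E} (hf : Differentiable ℂ f) (v : X) :
    TendstoLocallyUniformly (fun (t : ℂ) x => t⁻¹ • (f (x + t • v) - f x))
      (fun x => fderiv ℂ f x v) (𝓝[≠] 0) := by
  refine Metric.tendstoLocallyUniformly_iff.2 fun ε hε x₀ => ?_
  obtain ⟨r, hr, hball⟩ : ∃ r > 0, ∀ y ∈ ball x₀ (r + r), f y ∈ ball (f x₀) 1 := by
    obtain ⟨δ, hδ, h⟩ := Metric.continuous_iff.1 hf.continuous x₀ 1 one_pos
    exact ⟨δ / 2, half_pos hδ, fun y hy => h y (by rwa [add_halves] at hy)⟩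
  have hmaps : ∀ x ∈ ball x₀ r, MapsTo f (ball x r) (closedBall (f x) 2) := fun x hx y hy => by
    have hfx := hball x (ball_subset_ball (by linarith) hx)
    have hfy := hball y (ball_subset_ball' (by linarith [mem_ball.1 hx]) hy)
    rw [mem_ball] at hfx hfy
    exact mem_closedBall.2 (by linarith [dist_triangle_right (f y) (f x) (f x₀)])
  have hsmall : ∀ᶠ t : ℂ in 𝓝[≠] 0, ‖t • v‖ < r ∧ 4 * (‖v‖ / r) ^ 2 * ‖t‖ < ε :=
    ((Continuous.tendsto' (by fun_prop) 0 0 (by simp)).eventually_lt_const hr |>.and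
      ((Continuous.tendsto' (by fun_prop) 0 0 (by simp)).eventually_lt_const hε)).filter_mono
      nhdsWithin_le_nhds
  refine ⟨ball x₀ r, ball_mem_nhds _ hr, ?_⟩
  filter_upwards [hsmall, self_mem_nhdsWithin] with t ⟨htv, htε⟩ ht0 x hx
  have hrem := norm_sub_sub_fderiv_le_of_mapsTo_ball hf.differentiableOn (hmaps x hx)
    (x := x + t • v) (by simpa using htv)
  have ht : 0 < ‖t‖ := norm_pos_iff.2 ht0
  calc dist (fderiv ℂ f x v) (t⁻¹ • (f (x + t • v) - f x))
      = ‖t‖⁻¹ * ‖f (x + t • v) - f x - fderiv ℂ f x (x + t • v - x)‖ := by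
        rw [dist_comm, dist_eq_norm, ← norm_inv, ← norm_smul, add_sub_cancel_left, map_smul,
          smul_sub, smul_sub, smul_sub, inv_smul_smul₀ ht0]
    _ ≤ ‖t‖⁻¹ * (2 * 2 * (‖t • v‖ / r) ^ 2) := by
        rw [add_sub_cancel_left] at hrem ⊢
        gcongr
    _ = 4 * (‖v‖ / r) ^ 2 * ‖t‖ := by
        rw [norm_smul]
        field_simp
        ring
    _ < ε := htε

theorem differentiable_fderiv_comp_apply [CompleteSpace E] {f : X → E} (hf : Differentiable ℂ f)
    {γ : ℂ → X} (hγ : Differentiable ℂ γ) (v : X) :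
    Differentiable ℂ fun s => fderiv ℂ f (γ s) v := by
  have hlim := (tendstoLocallyUniformly_lineDiffQuot hf v).comp γ hγ.continuous
  exact differentiableOn_univ.1 <|
    (tendstoLocallyUniformlyOn_univ.2 hlim).differentiableOn
      (.of_forall fun t => by
        simp only [Function.comp_def]
        fun_prop) isOpen_univ

theorem eq_of_forall_ofReal_eq [CompleteSpace E] {f g : ℂ → E} (hf : Differentiable ℂ f)
    (hg : Differentiable ℂ g) (h : ∀ x : ℝ, f x = g x) : f = g := by
  have hreal : Tendsto ((↑) : ℝ → ℂ) (𝓝[≠] 0) (𝓝[≠] 0) :=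
    continuous_ofReal.continuousWithinAt.tendsto_nhdsWithin fun x hx => ofReal_ne_zero.2 hx
  exact AnalyticOnNhd.eq_of_frequently_eq (z₀ := 0) (fun z _ => hf.analyticAt z)
    (fun z _ => hg.analyticAt z) (hreal.frequently (Frequently.of_forall h))

-- The automorphism `(x, y) ↦ (x + i y, x - i y)` of `ℂ²` maps `ℝ²` onto the set of points
-- `(s, conj s)`, and on `ℝ²` the identity theorem applies to one variable at a time.
theorem eq_of_forall_conj_eq [CompleteSpace E] {f g : ℂ × ℂ → E} (hf : Differentiable ℂ f)
    (hg : Differentiable ℂ g) (h : ∀ s, f (s, conj s) = g (s, conj s)) : f = g := by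
  have hreal : ∀ x y : ℝ, f (x + I * y, x - I * y) = g (x + I * y, x - I * y) := fun x y => by
    simpa [sub_eq_add_neg] using h (x + I * y)
  have hcomplex : ∀ x y : ℂ, f (x + I * y, x - I * y) = g (x + I * y, x - I * y) := fun x =>
    congrFun <| eq_of_forall_ofReal_eq (by fun_prop) (by fun_prop) fun y =>
      congrFun (eq_of_forall_ofReal_eq (f := fun x : ℂ => f (x + I * y, x - I * y))
        (g := fun x : ℂ => g (x + I * y, x - I * y)) (by fun_prop) (by fun_prop) (hreal · y)) x
  ext ⟨s, σ⟩
  have hs : (s + σ) / 2 + I * (-I * (s - σ) / 2) = s := by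
    linear_combination -(s - σ) / 2 * I_mul_I
  have hσ : (s + σ) / 2 - I * (-I * (s - σ) / 2) = σ := by
    linear_combination (s - σ) / 2 * I_mul_I
  simpa only [hs, hσ] using hcomplex ((s + σ) / 2) (-I * (s - σ) / 2)

end HolomorphicMaps

theorem exists_forall_eq_smul_of_countable {𝕜 X E : Type*} [NontriviallyNormedField 𝕜]
    [NormedAddCommGroup X] [NormedSpace 𝕜 X] [BaireSpace X] [PreconnectedSpace X]
    [NormedAddCommGroup E] [NormedSpace 𝕜 E] {f g : X → E} (hf : AnalyticOnNhd 𝕜 f univ)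
    (hg : AnalyticOnNhd 𝕜 g univ) {S : Set 𝕜} (hS : S.Countable)
    (h : ∀ x, ∃ μ ∈ S, f x = μ • g x) : ∃ μ ∈ S, ∀ x, f x = μ • g x := by
  have := hS.to_subtype
  have hclosed : ∀ μ : S, IsClosed {x | f x = (μ : 𝕜) • g x} := fun μ =>
    isClosed_eq hf.continuous (hg.continuous.const_smul _)
  have hcover : ⋃ μ : S, {x | f x = (μ : 𝕜) • g x} = univ :=
    iUnion_eq_univ_iff.2 fun x => (h x).elim fun μ hμ => ⟨⟨μ, hμ.1⟩, hμ.2⟩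
  obtain ⟨⟨μ, hμ⟩, x₀, hx₀⟩ := nonempty_interior_of_iUnion_of_closed hclosed hcover
  exact ⟨μ, hμ, congrFun <|
    hf.eq_of_eventuallyEq (hg.const_smul (c := μ)) (mem_interior_iff_mem_nhds.1 hx₀)⟩

section Polarization

variable {E : Type*} [NormedAddCommGroup E] [InnerProductSpace ℂ E] {m : ℂ → E}

theorem differentiable_inner_comp_conj (hm : Differentiable ℂ m) :
    Differentiable ℂ fun p : ℂ × ℂ => ⟪m (conj p.2), m p.1⟫_ℂ := by
  have hbra : Differentiable ℂ fun s : ℂ => innerSL ℂ (m (conj s)) := fun s =>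
    ((hm (conj s)).hasFDerivAt.comp_semilinear (innerSL ℂ)
      (starL ℂ : ℂ ≃L⋆[ℂ] ℂ).toContinuousLinearMap).differentiableAt
  exact (hbra.comp differentiable_snd).clm_apply (hm.comp differentiable_fst)

theorem inner_eq_of_norm_sq_eq (hm : Differentiable ℂ m) {N : ℂ × ℂ → ℂ}
    (hN : Differentiable ℂ N) (h : ∀ s, (‖m s‖ : ℂ) ^ 2 = N (s, conj s)) (s s' : ℂ) :
    ⟪m s', m s⟫_ℂ = N (s, conj s') := by
  have hpol := eq_of_forall_conj_eq (differentiable_inner_comp_conj hm) hN fun s => by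
    simpa [inner_self_eq_norm_sq_to_K] using h s
  simpa using congrFun hpol (s, conj s')

theorem inner_eq_of_norm_sq_eq_exp (hm : Differentiable ℂ m) {C c : ℝ}
    (h : ∀ s, ‖m s‖ ^ 2 = C * Real.exp (c * ‖s‖ ^ 2)) (s s' : ℂ) :
    ⟪m s', m s⟫_ℂ = C * exp (c * (s * conj s')) :=
  inner_eq_of_norm_sq_eq hm (N := fun p => C * exp (c * (p.1 * p.2))) (by fun_prop)
    (fun s => by rw [mul_conj']; exact_mod_cast h s) s s'

-- Parallel vectors realise equality in the Cauchy-Schwarz inequality, which here reads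
-- `‖s - s'‖ ^ 2 = 0`.
theorem eq_of_eq_smul_of_norm_sq_eq_exp (hm : Differentiable ℂ m) {C c : ℝ} (hC : C ≠ 0)
    (hc : c ≠ 0) (h : ∀ s, ‖m s‖ ^ 2 = C * Real.exp (c * ‖s‖ ^ 2)) {s s' ν : ℂ}
    (hν : m s = ν • m s') : s = s' := by
  have hparallel : ‖⟪m s', m s⟫_ℂ‖ ^ 2 = ‖m s'‖ ^ 2 * ‖m s‖ ^ 2 := by
    rw [hν, inner_smul_right, norm_mul, norm_smul, inner_self_eq_norm_sq_to_K]
    simp only [coe_algebraMap, norm_pow, norm_real, norm_norm]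
    ring
  have hexp : Real.exp (2 * (c * (s * conj s').re)) = Real.exp (c * ‖s'‖ ^ 2 + c * ‖s‖ ^ 2) := by
    rw [inner_eq_of_norm_sq_eq_exp hm h, h, h, norm_mul, norm_exp, norm_real, mul_pow,
      ← Real.exp_nat_mul, Real.norm_eq_abs, sq_abs, re_ofReal_mul] at hparallel
    rw [Real.exp_add]
    refine mul_left_cancel₀ (pow_ne_zero 2 hC) ?_
    push_cast at hparallel
    linear_combination hparallel
  have hre : ‖s - s'‖ ^ 2 = 0 := by
    rw [← normSq_eq_norm_sq, normSq_sub, normSq_eq_norm_sq, normSq_eq_norm_sq]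
    refine mul_left_cancel₀ hc ?_
    linear_combination -Real.exp_injective hexp
  simpa [sub_eq_zero] using hre

end Polarization

theorem contDiff_uCoord {n : WithTop ℕ∞} : ContDiff ℝ n uCoord := by
  unfold uCoord
  simp only [normSq_eq_norm_sq]
  exact ((contDiff_fst.norm_sq ℝ).div_const 2).add (imCLM.contDiff.comp contDiff_snd)

theorem contDiff_potential {n : WithTop ℕ∞} : ContDiff ℝ n potential :=
  (contDiff_uCoord.div_const 2).exp

theorem fderiv_uCoord_vertical (p : ℂ × ℂ) (v : ℂ) : fderiv ℝ uCoord p (0, v) = v.im := by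
  have hline : HasLineDerivAt ℝ uCoord v.im p (0, v) := by
    have : (fun t : ℝ => uCoord (p + t • ((0, v) : ℂ × ℂ))) = fun t => uCoord p + t * v.im := by
      simp [uCoord, add_assoc]
    simpa only [HasLineDerivAt, this, id_eq, one_mul] using
      ((hasDerivAt_id (0 : ℝ)).mul_const v.im).const_add (uCoord p)
  rw [← hline.lineDeriv, (contDiff_uCoord.differentiable one_ne_zero p).lineDeriv_eq_fderiv]

theorem fderiv_potential_vertical (p : ℂ × ℂ) (v : ℂ) :
    fderiv ℝ potential p (0, v) = v.im / 2 * potential p := by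
  have hu := (contDiff_uCoord.differentiable one_ne_zero p).hasFDerivAt
  have hpot : HasFDerivAt potential _ p := (hu.mul_const (2⁻¹ : ℝ)).exp
  rw [hpot.fderiv]
  simp only [smul_apply, fderiv_uCoord_vertical, smul_eq_mul, potential,
    div_eq_mul_inv]
  ring

theorem fderiv_fderiv_potential_vertical (p : ℂ × ℂ) (v v' : ℂ) :
    fderiv ℝ (fderiv ℝ potential) p (0, v) (0, v') = v.im / 2 * (v'.im / 2) * potential p := by
  have hdiff : DifferentiableAt ℝ (fderiv ℝ potential) p :=
    (contDiff_potential.fderiv_right (m := 1) le_rfl).differentiable one_ne_zero p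
  calc fderiv ℝ (fderiv ℝ potential) p (0, v) (0, v')
      = fderiv ℝ (fun q => fderiv ℝ potential q (0, v')) p (0, v) := by
        simp [fderiv_clm_apply hdiff (differentiableAt_const _)]
    _ = v.im / 2 * (v'.im / 2) * potential p := by
        simp only [fderiv_potential_vertical]
        rw [fderiv_const_mul (contDiff_potential.differentiable one_ne_zero p)]
        simp only [smul_apply, fderiv_potential_vertical, smul_eq_mul]
        ring

theorem kahlerForm_vertical (p : ℂ × ℂ) : kahlerForm p (0, 1) (0, I) = potential p / 16 := by
  simp only [kahlerForm, potentialForm, Prod.smul_mk, smul_eq_mul, mul_zero, mul_one, I_mul_I,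
    fderiv_fderiv_potential_vertical, I_im, one_im, neg_im]
  ring

theorem norm_sq_cexp_mul_potential (p : ℂ × ℂ) :
    ‖exp (I * p.2 / 4)‖ ^ 2 * potential p = Real.exp (1 / 4 * ‖p.1‖ ^ 2) := by
  rw [norm_exp, ← Real.exp_nat_mul, potential, ← Real.exp_add, uCoord, normSq_eq_norm_sq]
  congr 1
  simp only [Nat.cast_ofNat, div_ofNat_re, mul_re, I_re, I_im]
  ring

namespace IsKahlerMap

variable {a : ℝ} {F : ℂ × ℂ → EllTwo}

theorem linearIsometry_comp_add_const (hF : IsKahlerMap a F) (U : EllTwo →ₗᵢ[ℂ] EllTwo)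
    (c : EllTwo) : IsKahlerMap a fun p => U (F p) + c := by
  have hfderiv : ∀ p, HasFDerivAt (fun p => U (F p) + c)
      (U.toContinuousLinearMap.comp (fderiv ℂ F p)) p := fun p =>
    (U.toContinuousLinearMap.hasFDerivAt.comp p (hF.1 p).hasFDerivAt).add_const c
  refine ⟨fun p => (hfderiv p).differentiableAt, fun p ξ η => ?_⟩
  rw [← hF.2 p ξ η, pullback, pullback, (hfderiv p).fderiv, flatForm, flatForm]
  exact congrArg im (U.inner_map_map _ _)

theorem norm_sq_fderiv_vertical (hF : IsKahlerMap a F) (p : ℂ × ℂ) :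
    ‖fderiv ℂ F p (0, 1)‖ ^ 2 = a / 16 * potential p := by
  have hI : fderiv ℂ F p (0, I) = I • fderiv ℂ F p (0, 1) := by
    simp [← map_smul]
  have h := hF.2 p (0, 1) (0, I)
  rw [pullback, flatForm, hI, inner_smul_right, inner_self_eq_norm_sq_to_K,
    kahlerForm_vertical] at h
  rw [div_mul_eq_mul_div, mul_div_assoc, ← h]
  simp [← ofReal_pow]

theorem fst_eq_fst_of_fderiv_vertical_eq_smul (hF : IsKahlerMap a F) (ha : a ≠ 0) {p q : ℂ × ℂ}
    {ν : ℂ} (h : fderiv ℂ F p (0, 1) = ν • fderiv ℂ F q (0, 1)) : p.1 = q.1 := by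
  by_contra hpq
  obtain ⟨φ, hφ, hφp, hφq⟩ : ∃ φ : ℂ → ℂ, Differentiable ℂ φ ∧ φ p.1 = p.2 ∧ φ q.1 = q.2 :=
    ⟨fun s => q.2 + (s - q.1) * ((p.2 - q.2) / (p.1 - q.1)), by fun_prop,
      by simp [mul_div_cancel₀ _ (sub_ne_zero.2 hpq)], by simp⟩
  set m : ℂ → EllTwo := fun s => exp (I * φ s / 4) • fderiv ℂ F (s, φ s) (0, 1) with hm
  have hmdiff : Differentiable ℂ m := Differentiable.fun_smul (by fun_prop)
    (differentiable_fderiv_comp_apply hF.1 (differentiable_id.prodMk hφ) (0, 1))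
  have hmnorm : ∀ s, ‖m s‖ ^ 2 = a / 16 * Real.exp (1 / 4 * ‖s‖ ^ 2) := fun s => by
    rw [hm, norm_smul, mul_pow, hF.norm_sq_fderiv_vertical, mul_left_comm,
      norm_sq_cexp_mul_potential (s, φ s)]
  refine hpq (eq_of_eq_smul_of_norm_sq_eq_exp hmdiff (by positivity) (by norm_num) hmnorm
    (ν := exp (I * p.2 / 4) * ν * (exp (I * q.2 / 4))⁻¹) ?_)
  simp only [hm, hφp, hφq, h, smul_smul]
  rw [inv_mul_cancel_right₀ (exp_ne_zero _)]

theorem eq_of_forall_vertical_eq_smul (hF : IsKahlerMap a F) (ha : a ≠ 0) {z z' w w' μ : ℂ}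
    (h : ∀ s, F (z, w + s) = μ • F (z', w' + s)) : z = z' := by
  have hderiv : ∀ z w, HasDerivAt (fun s => F (z, w + s)) (fderiv ℂ F (z, w) (0, 1)) 0 := by
    intro z w
    have hline : HasDerivAt (fun s => (z, w + s)) ((0, 1) : ℂ × ℂ) 0 :=
      (hasDerivAt_const 0 z).prodMk ((hasDerivAt_id 0).const_add w)
    exact (hF.1 _).hasFDerivAt.comp_hasDerivAt_of_eq 0 hline (by simp)
  refine hF.fst_eq_fst_of_fderiv_vertical_eq_smul ha (p := (z, w)) (q := (z', w')) (ν := μ) ?_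
  refine (hderiv z w).unique ?_
  simpa only [h] using! (hderiv z' w').const_smul μ

end IsKahlerMap

theorem HeisR.mem_center_iff {g : HeisR} : g ∈ Subgroup.center HeisR ↔ g.x = 0 ∧ g.y = 0 := by
  rw [Subgroup.mem_center_iff]
  refine ⟨fun h => ⟨?_, ?_⟩, fun ⟨hx, hy⟩ h => ?_⟩
  · simpa [mul_def] using congrArg HeisR.t (h ⟨0, 1, 0, 0⟩)
  · simpa [mul_def] using congrArg HeisR.t (h ⟨1, 0, 0, 0⟩)
  · ext <;> simp [mul_def, hx, hy, add_comm]

theorem coords_fst_eq_zero_iff {g : HeisR} : (coords g).1 = 0 ↔ g.x = 0 ∧ g.y = 0 := by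
  simp [coords, Complex.ext_iff]

theorem coords_mul (g h : HeisR) :
    coords (g * h) = ((coords g).1 + (coords h).1,
      (coords g).2 + (coords h).2 - I * conj (coords g).1 * (coords h).1) := by
  have hsqrt : ((Real.sqrt 2 : ℝ) : ℂ) ^ 2 = 2 := by
    rw [← ofReal_pow, Real.sq_sqrt zero_le_two, ofReal_ofNat]
  have hsqrt0 : ((Real.sqrt 2 : ℝ) : ℂ) ≠ 0 := by simp
  ext1
  · simp only [coords, HeisR.mul_def, Equiv.coe_fn_mk]
    push_cast
    ring
  · simp only [coords, HeisR.mul_def, Equiv.coe_fn_mk, map_div₀, map_add, map_mul, conj_ofReal,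
      conj_I]
    field_simp
    rw [hsqrt]
    push_cast
    linear_combination 8 * (g.x * h.y - g.y * h.x - I * g.y * h.y) * I_mul_I

theorem cover_coords_mul {Γ : Subgroup HeisR} {g : HeisR} (hg : g ∈ Γ) (h : HeisR) :
    cover Γ (coords (g * h)) = cover Γ (coords h) := by
  refine Quotient.sound ?_
  rw [Equiv.symm_apply_apply, Equiv.symm_apply_apply]
  exact ⟨⟨g, hg⟩, rfl⟩

theorem cover_vertical {Γ : Subgroup HeisR} {g : HeisR} (hg : g ∈ Γ) (w : ℂ) :
    cover Γ ((coords g).1, (coords g).2 + w) = cover Γ (0, w) := by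
  simpa [coords_mul] using cover_coords_mul hg (coords.symm (0, w))

theorem not_le_center_of_compactSpace (Γ : Subgroup HeisR) [CompactSpace (Surface Γ)] :
    ¬ Γ ≤ Subgroup.center HeisR := by
  intro hΓ
  have hx : Continuous HeisR.x :=
    continuous_fst.comp (continuous_induced_dom (f := fun g : HeisR => (g.x, g.y, g.t, g.u)))
  let X : Surface Γ → ℝ := Quotient.lift HeisR.x <| by
    rintro _ h ⟨g, rfl⟩
    change (g : HeisR).x + h.x = h.x
    rw [(HeisR.mem_center_iff.1 (hΓ g.2)).1, zero_add]
  have hX : Continuous X := hx.quotient_lift _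
  obtain ⟨C, hC⟩ := (isCompact_range hX).bddAbove
  exact (lt_add_one C).not_ge (hC ⟨Quotient.mk _ ⟨C + 1, 0, 0, 0⟩, rfl⟩)

theorem hopfCover_eq_iff {lam : ℂˣ} {v v' : EllTwo} (hv : v ≠ 0) (hv' : v' ≠ 0) :
    hopfCover lam v hv = hopfCover lam v' hv' ↔ ∃ n : ℤ, v = (lam : ℂ) ^ n • v' := by
  refine (Quotient.eq (r := hopfSetoid lam)).trans ?_
  change v ∈ MulAction.orbit (Subgroup.zpowers lam) v' ↔ _
  simp [MulAction.mem_orbit_iff, Subgroup.exists_zpowers, Subgroup.smul_def, Units.smul_def,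
    eq_comm]

theorem IsKahlerMap.le_center_of_cover_eq {Γ : Subgroup HeisR} {a : ℝ} (ha : a ≠ 0)
    {F : ℂ × ℂ → EllTwo} (hF : IsKahlerMap a F) {S : Set ℂ} (hS : S.Countable)
    (h : ∀ p q, cover Γ p = cover Γ q → ∃ μ ∈ S, F p = μ • F q) :
    Γ ≤ Subgroup.center HeisR := by
  intro g hg
  have hanalytic : ∀ z w, AnalyticOnNhd ℂ (fun s => F (z, w + s)) univ := fun z w s _ =>
    (hF.1.comp (by fun_prop : Differentiable ℂ fun s => (z, w + s))).analyticAt s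
  obtain ⟨μ, -, hμ⟩ := exists_forall_eq_smul_of_countable (hanalytic _ _) (hanalytic _ _) hS
    fun w => h ((coords g).1, (coords g).2 + w) (0, 0 + w) (by rw [zero_add, cover_vertical hg])
  exact HeisR.mem_center_iff.2 <| coords_fst_eq_zero_iff.1 <|
    hF.eq_of_forall_vertical_eq_smul ha hμ

end Kodaira

theorem mainTheorem11_general (Γ : Subgroup Kodaira.HeisR)
    (hΓ : ¬ Γ ≤ Subgroup.center Kodaira.HeisR) (a : ℝ) (ha : a ≠ 0)
    (F : ℂ × ℂ → Kodaira.EllTwo) (hF : Kodaira.IsKahlerMap a F) :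
    (∀ lam : ℂˣ, ¬ ∃ f : Kodaira.Surface Γ → Kodaira.Hopf lam, Kodaira.InducesToHopf F f) ∧
    ¬ ∃ f : Kodaira.Surface Γ → Kodaira.EllTwo, ∀ p, f (Kodaira.cover Γ p) = F p := by
  refine ⟨fun lam ⟨f, hf⟩ => hΓ ?_, fun ⟨f, hf⟩ => hΓ ?_⟩
  · choose hF0 hf using hf
    refine hF.le_center_of_cover_eq ha (Set.countable_range fun n : ℤ => (lam : ℂ) ^ n) ?_
    intro p q hpq
    rw [Set.exists_range_iff, ← Kodaira.hopfCover_eq_iff (hF0 p) (hF0 q), ← hf, ← hf, hpq]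
  · refine hF.le_center_of_cover_eq ha (Set.countable_singleton 1) fun p q hpq => ⟨1, rfl, ?_⟩
    rw [one_smul, ← hf, ← hf, hpq]

theorem mainTheorem11 (Γ : Subgroup Kodaira.HeisR) (hdiscrete : DiscreteTopology Γ)
    (hcompact : CompactSpace (Kodaira.Surface Γ)) (a : ℝ) (ha : 0 < a)
    (F : ℂ × ℂ → Kodaira.EllTwo) (hF : Kodaira.IsKahlerMap a F) :
    (∀ lam : ℂˣ, ‖(lam : ℂ)‖ ≠ 1 → ∀ b : ℝ, 0 < b →
      ¬ ∃ f : Kodaira.Surface Γ → Kodaira.Hopf lam,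
        Kodaira.IsLcKMap b f ∧ Kodaira.InducesToHopf F f) ∧
    ∀ (U : Kodaira.EllTwo ≃ₗᵢ[ℂ] Kodaira.EllTwo) (c : Kodaira.EllTwo),
      (∀ lam : ℂˣ, ‖(lam : ℂ)‖ ≠ 1 →
        ¬ ∃ f : Kodaira.Surface Γ → Kodaira.Hopf lam,
          Kodaira.InducesToHopf (fun p => U (F p) + c) f) ∧
      ¬ ∃ f : Kodaira.Surface Γ → Kodaira.EllTwo,
        ∀ p, f (Kodaira.cover Γ p) = U (F p) + c := by
  have hdescent := mainTheorem11_general Γ (Kodaira.not_le_center_of_compactSpace Γ) a ha.ne'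
  refine ⟨fun lam _ b _ ⟨f, _, hf⟩ => (hdescent F hF).1 lam ⟨f, hf⟩, fun U c => ?_⟩
  exact (hdescent _ (hF.linearIsometry_comp_add_const U.toLinearIsometry c)).imp_left
    fun h lam _ => h lam
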